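/- Let $q$ be a prime power. For a linear code $C\subseteq\mathbb F_{q^2}^n$ let $C^{\perp_H}=\{u\in\mathbb F_{q^2}^n : \sum_{i=1}^n u_iv_i^q=0 \text{ for all } v\in C\}$ be its Hermitian dual and $\mathrm{Hull}_H(C)=C\cap C^{\perp_H}$ its Hermitian hull. For a set $X$ of vectors let $\mathrm{wt}(X)$ be the smallest Hamming weight of a nonzero vector in $X$. An $[[n,\kappa,r,\geq d]]_q$ subsystem code is a subspace of $(\mathbb C^q)^{\otimes n}$ together with a unitary identification of it with a tensor product $A\otimes B$, where $\dim A=q^\kappa$ (the information subsystem) and $\dim B=q^r$ (the gauge subsystem), such that every linear operator $E$ on $(\mathbb C^q)^{\otimes n}$ that acts on fewer than $d$ of the $n$ tensor factors is detectable on $A$, that is, satisfies $PEP|_{A\otimes B}=1_A\otimes M$ for some operator $M$ on $B$, where $P$ is the orthogonal projection onto the code space. Let $C\subseteq\mathbb F_{q^2}^n$ be a linear code of dimension $k$ whose Hermitian hull has dimension $\ell$, and suppose $k+\ell<n$. Let $[[n,\kappa,r,\delta]]_q$ be the parameters of the Clifford subsystem code constructed from $C$, that is, $$\kappa=n-k-\ell,\qquad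 r=k-\ell,\qquad \delta=\mathrm{wt}\bigl(\mathrm{Hull}_H(C)^{\perp_H}\setminus C\bigr).$$ Then the following hold. 1. For each $s\in\{1,\dots,\ell\}$ there exists an $[[n-s,\kappa,r+s,\geq\delta-s]]_q$ subsystem code. 2. If the Clifford subsystem code is pure, that is, if $\delta=\mathrm{wt}\bigl(\mathrm{Hull}_H(C)^{\perp_H}\bigr)$, then for each $s\in\{1,\dots,\ell\}$ there exists an $[[n-s,\kappa+s,r,\geq\delta-s]]_q$ subsystem code. -/

import Mathlib

open scoped Kronecker Matrix

/-- The Hermitian dual of a code `C` of length `n` over the field `F` with `q ^ 2` elements: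
the vectors `u` with `∑ i, u i * (v i) ^ q = 0` for all `v ∈ C`. -/
def hermitianDual (q : ℕ) {F : Type*} [Field F] {n : ℕ} (C : Submodule F (Fin n → F)) :
    Submodule F (Fin n → F) where
  carrier := {u | ∀ v ∈ C, ∑ i, u i * v i ^ q = 0}
  zero_mem' := by
    intro v _
    simp
  add_mem' := by
    intro a b ha hb v hv
    simp [add_mul, Finset.sum_add_distrib, ha v hv, hb v hv]
  smul_mem' := by
    intro c a ha v hv
    simp [mul_assoc, ← Finset.mul_sum, ha v hv]

/-- The Hermitian hull of a code: its intersection with its Hermitian dual. -/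
def hermitianHull (q : ℕ) {F : Type*} [Field F] {n : ℕ} (C : Submodule F (Fin n → F)) :
    Submodule F (Fin n → F) :=
  C ⊓ hermitianDual q C

/-- The smallest Hamming weight of a nonzero vector in a set of vectors.
For a linear code this is the minimum distance. -/
noncomputable def minWeight {F : Type*} [Field F] [DecidableEq F] {n : ℕ}
    (X : Set (Fin n → F)) : ℕ :=
  sInf {w | ∃ v ∈ X, v ≠ 0 ∧ hammingNorm v = w}

/-- The linear code `C` of length `n` over the field with `q ^ 2` elements, of dimension `k` and
with Hermitian hull of dimension `l`, satisfies `k + l < n`, and the Clifford subsystem code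
constructed from it has parameters `[[n, κ, r, δ]]_q`, that is, `κ = n - k - l`, `r = k - l`, and
`δ` is the minimum weight of the set difference of the Hermitian dual of the hull and `C`. -/
structure IsCliffordSubsystemSource (q : ℕ) {F : Type*} [Field F] [DecidableEq F] {n : ℕ}
    (C : Submodule F (Fin n → F)) (κ r δ : ℕ) : Prop where
  lt_length : Module.finrank F C + Module.finrank F (hermitianHull q C) < n
  kappa_eq : κ + Module.finrank F C + Module.finrank F (hermitianHull q C) = n
  r_eq : r + Module.finrank F (hermitianHull q C) = Module.finrank F C
  delta_eq : δ = minWeight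
    ((hermitianDual q (hermitianHull q C) : Set (Fin n → F)) \ (C : Set (Fin n → F)))

/-- The Clifford subsystem code of minimum distance `δ` constructed from `C` is pure:
`δ` is the minimum distance of the Hermitian dual of the hull of `C`. -/
def IsPureSource (q : ℕ) {F : Type*} [Field F] [DecidableEq F] {n : ℕ}
    (C : Submodule F (Fin n → F)) (δ : ℕ) : Prop :=
  δ = minWeight (hermitianDual q (hermitianHull q C) : Set (Fin n → F))

/-- An operator on `n` qudits with `q` levels, written as a matrix in the computational basis
`Fin n → Fin q` of the `n`-fold tensor power of `ℂ ^ q`, acts only on the positions in `T`: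
it is the tensor product of some operator `f` on the positions in `T` with the identity on the
remaining positions. -/
def ActsOn {q n : ℕ} (T : Finset (Fin n)) (E : Matrix (Fin n → Fin q) (Fin n → Fin q) ℂ) :
    Prop :=
  ∃ f : Matrix (T → Fin q) (T → Fin q) ℂ, ∀ x y : Fin n → Fin q,
    ((∀ i ∉ T, x i = y i) → E x y = f (fun i => x i) (fun i => y i)) ∧
    (¬ (∀ i ∉ T, x i = y i) → E x y = 0)

/-- A subsystem code with parameters `[[n, κ, r]]_q`: a subspace of the `n`-fold tensor power of
`ℂ ^ q` identified with a tensor product `A ⊗ B`, where `dim A = q ^ κ` (the information subsystem)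
and `dim B = q ^ r` (the gauge subsystem). The identification is the isometric embedding of
`A ⊗ B` whose matrix is `embed`, with respect to the product of orthonormal bases of `A` and `B`
and to the computational basis; the subspace is its range. -/
structure SubsystemCode (q n κ r : ℕ) where
  embed : Matrix (Fin n → Fin q) (Fin (q ^ κ) × Fin (q ^ r)) ℂ
  isometry : embedᴴ * embed = 1

/-- The error `E` is detectable on the information subsystem: compressed to the code space
`A ⊗ B` it has the form `1 ⊗ M`, so it acts on the gauge subsystem `B` only. -/
def SubsystemCode.Detects {q n κ r : ℕ} (Q : SubsystemCode q n κ r)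
    (E : Matrix (Fin n → Fin q) (Fin n → Fin q) ℂ) : Prop :=
  ∃ M : Matrix (Fin (q ^ r)) (Fin (q ^ r)) ℂ,
    Q.embedᴴ * E * Q.embed = (1 : Matrix (Fin (q ^ κ)) (Fin (q ^ κ)) ℂ) ⊗ₖ M

/-- The minimum distance of the subsystem code is at least `d`: every error that acts on fewer
than `d` positions is detectable on the information subsystem. -/
def SubsystemCode.DistanceAtLeast {q n κ r : ℕ} (Q : SubsystemCode q n κ r) (d : ℕ) : Prop :=
  ∀ T : Finset (Fin n), T.card < d →
    ∀ E : Matrix (Fin n → Fin q) (Fin n → Fin q) ℂ, ActsOn T E → Q.Detects E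

/-! Let `K` be the subfield of `F` with `q` elements. A `K`-linear coordinate of the Hermitian form
turns `F ^ n` into a symplectic space over `K`, whose vectors index Weyl operators. Let `D` be the
orthogonal of `C` and `H = C ∩ D` the hull. Take a common eigenvector of the Weyl operators of
Lagrangians in `C` and in `D`; its translates by coset representatives from `D` and `C` span the
information and gauge factors. Operators from `C` act on the gauge factor only, and those outside
the dual of `H` compress to zero, so only vectors of that dual outside `C` can be undetected
(`SubsystemCode.exists_of_weyl`). Since Weyl operators supported on `T` span all operators on `T`,
this bounds the distance (`SubsystemCode.exists_of_code`).

The theorem is then a statement about classical codes. For part 1, puncturing `C` at a coordinate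
where the hull does not vanish keeps `k`, shortens the hull by one dimension and lowers the relevant
weights by at most one. For part 2, purity bounds every nonzero vector of the dual of `H`, so `H`
itself can be shortened. It yields a stabilizer code of dimension exponent `κ + r + s`, of which `r`
qudits are declared gauge. -/

/-! ### The subfield of index two and common eigenvectors -/

theorem exists_subfield_card_eq {F : Type*} [Field F] [Fintype F] {q : ℕ}
    (hq : Fintype.card F = q ^ 2) :
    ∃ K : Subfield F, Nat.card K = q ∧ Module.finrank K F = 2 := by
  obtain ⟨p, hp⟩ := CharP.exists F
  have : Fact p.Prime := ⟨CharP.char_is_prime F p⟩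
  let : Algebra (ZMod p) F := ZMod.algebra F p
  have hcard : Nat.card F = p ^ Module.finrank (ZMod p) F := by
    rw [Module.natCard_eq_pow_finrank (K := ZMod p), Nat.card_zmod]
  have heven : 2 ∣ Module.finrank (ZMod p) F := by
    have h1 : q ^ 2 = p ^ Module.finrank (ZMod p) F := by
      rw [← hcard, Nat.card_eq_fintype_card, hq]
    have hdvd : q ∣ p ^ Module.finrank (ZMod p) F := h1 ▸ dvd_pow_self q two_ne_zero
    obtain ⟨m, -, rfl⟩ := (Nat.dvd_prime_pow Fact.out).1 hdvd
    rw [← pow_mul] at h1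
    have := Nat.pow_right_injective (Fact.out : p.Prime).two_le h1
    omega
  -- The Galois group has even order, so Cauchy gives an involution; its fixed field has index two.
  rw [← IsGalois.card_aut_eq_finrank (ZMod p) F] at heven
  obtain ⟨σ, hσ⟩ := exists_prime_orderOf_dvd_card' 2 heven
  have hfin : Module.finrank (IntermediateField.fixedField (Subgroup.zpowers σ)) F = 2 := by
    rw [IntermediateField.finrank_fixedField_eq_card, Nat.card_zpowers, hσ]
  refine ⟨(IntermediateField.fixedField (Subgroup.zpowers σ)).toSubfield, ?_, hfin⟩
  have h2 := Module.natCard_eq_pow_finrank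
    (K := IntermediateField.fixedField (Subgroup.zpowers σ)) (V := F)
  rw [hfin, Nat.card_eq_fintype_card, hq] at h2
  exact (Nat.pow_left_injective two_ne_zero h2).symm

/-- Commuting operators on a nonzero finite-dimensional space over an algebraically closed field
have a common eigenvector. -/
theorem exists_common_eigenvector {k V ι : Type*} [Field k] [IsAlgClosed k] [AddCommGroup V]
    [Module k V] [FiniteDimensional k V] [Nontrivial V] [Finite ι] (f : ι → Module.End k V)
    (hf : ∀ i j, Commute (f i) (f j)) :
    ∃ x : V, x ≠ 0 ∧ ∃ μ : ι → k, ∀ i, f i x = μ i • x := by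
  classical
  cases nonempty_fintype ι
  suffices h : ∀ s : Finset ι, ∃ μ : ι → k, (⨅ i ∈ s, (f i).eigenspace (μ i)) ≠ ⊥ by
    obtain ⟨μ, hμ⟩ := h Finset.univ
    obtain ⟨x, hx, hx0⟩ := Submodule.exists_mem_ne_zero_of_ne_bot hμ
    refine ⟨x, hx0, μ, fun i => ?_⟩
    simp only [Submodule.mem_iInf] at hx
    exact Module.End.mem_eigenspace_iff.1 (hx i (Finset.mem_univ i))
  intro s
  induction s using Finset.induction_on with
  | empty => exact ⟨0, by simp⟩
  | insert j s hj ih =>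
    obtain ⟨μ, hμ⟩ := ih
    set U := ⨅ i ∈ s, (f i).eigenspace (μ i) with hU
    have hmaps : ∀ x ∈ U, f j x ∈ U := by
      intro x hx
      simp only [hU, Submodule.mem_iInf, Module.End.mem_eigenspace_iff] at hx ⊢
      intro i hi
      have := congrArg (fun g : Module.End k V => g x) (hf i j).eq
      simp only [Module.End.mul_apply] at this
      rw [this, hx i hi, map_smul]
    have : Nontrivial U := Submodule.nontrivial_iff_ne_bot.2 hμ
    obtain ⟨ν, hν⟩ := Module.End.exists_eigenvalue ((f j).restrict hmaps)
    obtain ⟨⟨y, hyU⟩, hy⟩ := hν.exists_hasEigenvector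
    refine ⟨Function.update μ j ν, ?_⟩
    refine (Submodule.ne_bot_iff _).2 ⟨y, ?_, fun h => hy.2 (Subtype.ext h)⟩
    simp only [Submodule.mem_iInf, Module.End.mem_eigenspace_iff]
    intro i hi
    rcases Finset.mem_insert.1 hi with rfl | his
    · have := hy.apply_eq_smul
      simpa using congrArg Subtype.val this
    · have hne : i ≠ j := fun h => hj (h ▸ his)
      rw [Function.update_of_ne hne]
      simp only [hU, Submodule.mem_iInf, Module.End.mem_eigenspace_iff] at hyU
      exact hyU i his

/-! ### Lagrangian subspaces of alternating forms -/

namespace LinearMap.BilinForm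

variable {K V : Type*} [Field K] [AddCommGroup V] [Module K V] [FiniteDimensional K V]

/-- An alternating form has a totally isotropic subspace that equals its own orthogonal. -/
theorem exists_orthogonal_eq_self (B : LinearMap.BilinForm K V) (hB : B.IsAlt) :
    ∃ L : Submodule K V, B.orthogonal L = L := by
  obtain ⟨L, -, hL⟩ := exists_maximal_ge_of_wellFoundedGT
    (fun L : Submodule K V => L ≤ B.orthogonal L) ⊥ bot_le
  refine ⟨L, le_antisymm (fun v hv => ?_) hL.prop⟩
  have hv' : ∀ l ∈ L, B l v = 0 := hv
  have hv'' : ∀ l ∈ L, B v l = 0 := fun l hl => hB.isRefl _ _ (hv' l hl)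
  -- Adjoining `v` keeps `L` isotropic because `B v v = 0`, so maximality forces `v ∈ L`.
  have hiso : L ⊔ K ∙ v ≤ B.orthogonal (L ⊔ K ∙ v) := by
    intro x hx y hy
    obtain ⟨l, hl, a, ha, rfl⟩ := Submodule.mem_sup.1 hx
    obtain ⟨l', hl', b, hb, rfl⟩ := Submodule.mem_sup.1 hy
    obtain ⟨a, rfl⟩ := Submodule.mem_span_singleton.1 ha
    obtain ⟨b, rfl⟩ := Submodule.mem_span_singleton.1 hb
    have h1 : B l' l = 0 := hL.prop hl l' hl'
    change B _ _ = 0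
    simp [h1, hv' l' hl', hv'' l hl, hB v]
  have := hL.le_of_ge hiso le_sup_left
  exact this (Submodule.mem_sup_right (Submodule.mem_span_singleton_self v))

/-- Every subspace `U` contains a totally isotropic subspace that equals its own orthogonal
inside `U`; twice its dimension is the dimension of `U` plus that of the radical of `U`. -/
theorem exists_lagrangian_in (B : LinearMap.BilinForm K V) (hB : B.IsAlt) (U : Submodule K V) :
    ∃ L ≤ U, U ⊓ B.orthogonal U ≤ L ∧ (∀ v ∈ U, v ∈ L ↔ ∀ l ∈ L, B l v = 0) ∧
      2 * Module.finrank K L =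
        Module.finrank K U + Module.finrank K (U ⊓ B.orthogonal U : Submodule K V) := by
  have hB' : (B.restrict U).IsAlt := fun x => hB x
  obtain ⟨L, hL⟩ := exists_orthogonal_eq_self (B.restrict U) hB'
  have hmem : ∀ v ∈ U, v ∈ L.map U.subtype ↔ ∀ l ∈ L.map U.subtype, B l v = 0 := by
    intro v hv
    have h1 : v ∈ L.map U.subtype ↔ (⟨v, hv⟩ : U) ∈ L := by simp [hv]
    rw [h1]
    nth_rw 1 [← hL]
    simp only [mem_orthogonal_iff, Submodule.mem_map]
    constructor
    · rintro h _ ⟨l, hl, rfl⟩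
      exact h l hl
    · intro h l hl
      exact h l ⟨l, hl, rfl⟩
  refine ⟨L.map U.subtype, Submodule.map_subtype_le U L, ?_, hmem, ?_⟩
  · rintro v ⟨hvU, hv⟩
    rw [hmem v hvU]
    rintro _ ⟨l, -, rfl⟩
    exact hv _ l.2
  · have h := finrank_add_finrank_orthogonal hB'.isRefl L
    rw [hL] at h
    have hle : (B.restrict U).orthogonal ⊤ ≤ L := by
      conv_rhs => rw [← hL]
      exact orthogonal_le le_top
    rw [inf_eq_right.2 hle] at h
    have h2 : ((B.restrict U).orthogonal ⊤).map U.subtype = U ⊓ B.orthogonal U := by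
      ext v
      constructor
      · rintro ⟨u, hu, rfl⟩
        exact ⟨u.2, fun w hw => hu ⟨w, hw⟩ trivial⟩
      · rintro ⟨hvU, hv⟩
        exact ⟨⟨v, hvU⟩, fun w _ => hv w.1 w.2, rfl⟩
    rw [← h2, Submodule.finrank_map_subtype_eq, Submodule.finrank_map_subtype_eq]
    omega

end LinearMap.BilinForm

/-! ### Weyl systems -/

/-- A projective unitary representation `W` of an additive group by complex matrices, in which
`W u` and `W v` commute up to the factor `χ u v`. -/
structure IsWeylSystem {V ι : Type*} [AddCommGroup V] [Fintype ι] [DecidableEq ι]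
    (W : V → Matrix ι ι ℂ) (χ : V → V → ℂ) : Prop where
  zero : W 0 = 1
  mul : ∀ u v, ∃ c : ℂ, c ≠ 0 ∧ W u * W v = c • W (u + v)
  comm : ∀ u v, W u * W v = χ u v • (W v * W u)
  unitary : ∀ u, (W u)ᴴ * W u = 1

namespace IsWeylSystem

variable {V ι : Type*} [AddCommGroup V] [Fintype ι] [DecidableEq ι]
  {W : V → Matrix ι ι ℂ} {χ : V → V → ℂ}

theorem dotProduct_mulVec (hW : IsWeylSystem W χ) (u : V) (x y : ι → ℂ) :
    star (W u *ᵥ x) ⬝ᵥ (W u *ᵥ y) = star x ⬝ᵥ y := by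
  rw [Matrix.star_mulVec, Matrix.dotProduct_mulVec, Matrix.vecMul_vecMul, hW.unitary,
    Matrix.vecMul_one]

/-- Applying the unitary `W m` to both arguments preserves the inner product. Moving it past `W w`
to the eigenvector `x` multiplies the product by `χ m w`, as `|μ| = 1`. -/
theorem dotProduct_eq_zero (hW : IsWeylSystem W χ) {x : ι → ℂ} {m w : V} {μ : ℂ}
    (hx : star x ⬝ᵥ x = 1) (hm : W m *ᵥ x = μ • x) (hχ : χ m w ≠ 1) :
    star x ⬝ᵥ (W w *ᵥ x) = 0 := by
  have hμ : star μ * μ = 1 := by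
    have h := hW.dotProduct_mulVec m x x
    rw [hm, star_smul, smul_dotProduct, dotProduct_smul, hx] at h
    simpa using h
  have h := hW.dotProduct_mulVec m x (W w *ᵥ x)
  rw [Matrix.mulVec_mulVec, hW.comm, Matrix.smul_mulVec, ← Matrix.mulVec_mulVec, hm,
    Matrix.mulVec_smul, star_smul, smul_dotProduct, dotProduct_smul, dotProduct_smul] at h
  simp only [smul_eq_mul] at h
  have h2 : (χ m w - 1) * (star x ⬝ᵥ (W w *ᵥ x)) = 0 := by
    linear_combination h - χ m w * (star x ⬝ᵥ (W w *ᵥ x)) * hμ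
  exact (mul_eq_zero.1 h2).resolve_left (sub_ne_zero.2 hχ)

/-- Up to a scalar, `W v * W d' * W c'` is `W d * W c * W w` with `w = v + d' + c' - d - c`; the
unitaries `W d` and `W c` then cancel. -/
theorem dotProduct_mulVec_eq_zero (hW : IsWeylSystem W χ) {x : ι → ℂ} {m : V} {μ : ℂ}
    (hx : star x ⬝ᵥ x = 1) (hm : W m *ᵥ x = μ • x) {d c d' c' v : V}
    (hχ : χ m (v + d' + c' - d - c) ≠ 1) :
    star (W d *ᵥ (W c *ᵥ x)) ⬝ᵥ (W v *ᵥ (W d' *ᵥ (W c' *ᵥ x))) = 0 := by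
  set w := v + d' + c' - d - c with hw
  obtain ⟨a₁, ha₁, h₁⟩ := hW.mul c w
  obtain ⟨a₂, ha₂, h₂⟩ := hW.mul d (c + w)
  obtain ⟨b₁, -, h₃⟩ := hW.mul d' c'
  obtain ⟨b₂, -, h₄⟩ := hW.mul v (d' + c')
  have hsum : v + (d' + c') = d + (c + w) := by rw [hw]; abel
  have e₁ : W d * (W c * W w) = (a₁ * a₂) • W (d + (c + w)) := by
    rw [h₁, Matrix.mul_smul, h₂, smul_smul]
  have e₂ : W v * (W d' * W c') = (b₁ * b₂ * (a₁ * a₂)⁻¹) • (W d * (W c * W w)) := by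
    rw [h₃, Matrix.mul_smul, h₄, smul_smul, e₁, smul_smul, hsum]
    congr 1
    field_simp
  have e₃ : W v *ᵥ (W d' *ᵥ (W c' *ᵥ x)) =
      (b₁ * b₂ * (a₁ * a₂)⁻¹) • (W d *ᵥ (W c *ᵥ (W w *ᵥ x))) := by
    simp only [Matrix.mulVec_mulVec]
    rw [e₂, Matrix.smul_mulVec]
  rw [e₃, dotProduct_smul, hW.dotProduct_mulVec, hW.dotProduct_mulVec,
    hW.dotProduct_eq_zero hx hm hχ, smul_zero]

theorem exists_unit_eigenvector [Nonempty ι] (hW : IsWeylSystem W χ) [Finite V] (M : Set V)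
    (hM : ∀ u ∈ M, ∀ v ∈ M, χ u v = 1) :
    ∃ x : ι → ℂ, star x ⬝ᵥ x = 1 ∧ ∀ m ∈ M, ∃ μ : ℂ, W m *ᵥ x = μ • x := by
  obtain ⟨x, hx0, μ, hμ⟩ := exists_common_eigenvector
    (fun m : M => Matrix.toLin' (W m)) (fun u v => by
      change _ * _ = _ * _
      rw [Module.End.mul_eq_comp, Module.End.mul_eq_comp, ← Matrix.toLin'_mul,
        ← Matrix.toLin'_mul, hW.comm, hM u u.2 v v.2, one_smul])
  have hsum : star x ⬝ᵥ x = ((∑ i, ‖x i‖ ^ 2 : ℝ) : ℂ) := by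
    simp only [dotProduct, Pi.star_apply, Complex.ofReal_sum, Complex.ofReal_pow]
    exact Finset.sum_congr rfl fun i _ => Complex.conj_mul' (x i)
  have hpos : 0 < ∑ i, ‖x i‖ ^ 2 := by
    obtain ⟨i, hi⟩ := Function.ne_iff.1 hx0
    exact Finset.sum_pos' (fun _ _ => by positivity)
      ⟨i, Finset.mem_univ i, by have := norm_pos_iff.2 hi; positivity⟩
  set S := ∑ i, ‖x i‖ ^ 2
  refine ⟨((Real.sqrt S)⁻¹ : ℂ) • x, ?_, fun m hm => ⟨μ ⟨m, hm⟩, ?_⟩⟩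
  · rw [star_smul, smul_dotProduct, dotProduct_smul, hsum]
    have h1 : ((Real.sqrt S : ℝ) : ℂ) ≠ 0 := by
      exact_mod_cast (Real.sqrt_pos.2 hpos).ne'
    have h2 : (S : ℂ) = (Real.sqrt S : ℂ) * (Real.sqrt S : ℂ) := by
      exact_mod_cast (Real.mul_self_sqrt hpos.le).symm
    have h3 : star ((Real.sqrt S : ℂ)⁻¹) = (Real.sqrt S : ℂ)⁻¹ := by
      rw [star_inv₀]
      exact congrArg _ (Complex.conj_ofReal _)
    rw [h3, h2, smul_eq_mul, smul_eq_mul]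
    field_simp
  · have h := hμ ⟨m, hm⟩
    rw [Matrix.toLin'_apply] at h
    rw [Matrix.mulVec_smul, h, smul_comm]

end IsWeylSystem

/-! ### Subsystem codes from Weyl systems -/

theorem Submodule.exists_incongruent_family {K V : Type*} [Field K] [Finite K] [AddCommGroup V]
    [Module K V] [FiniteDimensional K V] {L U : Submodule K V} (hLU : L ≤ U) {m : ℕ}
    (hm : Module.finrank K U = Module.finrank K L + m) :
    ∃ f : Fin (Nat.card K ^ m) → V, (∀ i, f i ∈ U) ∧ ∀ i j, f i - f j ∈ L → i = j := by
  have hfin : Module.finrank K (U ⧸ L.submoduleOf U) = m := by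
    have h1 := Submodule.finrank_quotient_add_finrank (L.submoduleOf U)
    have h2 := (Submodule.submoduleOfEquivOfLe hLU).finrank_eq
    omega
  have hcard : Nat.card (U ⧸ L.submoduleOf U) = Nat.card K ^ m := by
    rw [Module.natCard_eq_pow_finrank (K := K), hfin]
  have : Finite (U ⧸ L.submoduleOf U) := Module.finite_of_finite K
  let e := (Finite.equivFinOfCardEq hcard).symm
  refine ⟨fun i => (Quotient.out (e i)).1, fun i => (Quotient.out (e i)).2, fun i j h => ?_⟩
  apply e.injective
  rw [← Quotient.out_eq (e i), ← Quotient.out_eq (e j)]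
  exact (Submodule.Quotient.eq _).2 h

theorem Matrix.conjTranspose_mul_mul_of_apply {ι α : Type*} [Fintype ι] (w : α → ι → ℂ)
    (E : Matrix ι ι ℂ) (p p' : α) :
    ((Matrix.of fun i p => w p i)ᴴ * E * (Matrix.of fun i p => w p i)) p p' =
      star (w p) ⬝ᵥ (E *ᵥ w p') := by
  rw [Matrix.mul_assoc, Matrix.mul_apply]
  rfl

/-- The Lagrangians `LC` and `LD` have codimension `r` in `C` and `κ` in `D`, so their cosets label
bases of the gauge and information factors. Orthogonality of two basis vectors is witnessed by an
element of a Lagrangian that does not pair to zero with the difference of their labels. -/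
theorem SubsystemCode.exists_of_weyl {q n κ r : ℕ} {K V : Type*} [Field K] [Finite K]
    [AddCommGroup V] [Module K V] [FiniteDimensional K V] (hq : Nat.card K = q)
    {ψ : AddChar K ℂ} (hψ : ψ 1 ≠ 1) {B : LinearMap.BilinForm K V} (hB : B.IsAlt)
    {W : V → Matrix (Fin n → Fin q) (Fin n → Fin q) ℂ}
    (hW : IsWeylSystem W fun u v => ψ (B u v)) (C : Submodule K V)
    (hrad : B.orthogonal C ⊓ B.orthogonal (B.orthogonal C) = C ⊓ B.orthogonal C)
    (hC : Module.finrank K C =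
      Module.finrank K (C ⊓ B.orthogonal C : Submodule K V) + 2 * r)
    (hD : Module.finrank K (B.orthogonal C) =
      Module.finrank K (C ⊓ B.orthogonal C : Submodule K V) + 2 * κ) :
    ∃ Q : SubsystemCode q n κ r,
      ∀ v, v ∈ C ∨ v ∉ B.orthogonal (C ⊓ B.orthogonal C) → Q.Detects (W v) := by
  subst hq
  have : Finite V := Module.finite_of_finite K
  have : NeZero (Nat.card K) := ⟨Nat.card_pos.ne'⟩
  set D := B.orthogonal C with hDdef
  have hCD : ∀ c ∈ C, ∀ d ∈ D, B c d = 0 := fun c hc d hd => hd c hc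
  have hDC : ∀ d ∈ D, ∀ c ∈ C, B d c = 0 := fun d hd c hc => hB.isRefl _ _ (hCD c hc d hd)
  obtain ⟨LC, hLC, hHLC, hLCmem, hLCdim⟩ := B.exists_lagrangian_in hB C
  obtain ⟨LD, hLD, -, hLDmem, hLDdim⟩ := B.exists_lagrangian_in hB D
  rw [hrad] at hLDdim
  rw [← hDdef] at hLCdim hHLC
  obtain ⟨c, hcC, hc⟩ := Submodule.exists_incongruent_family (m := r) hLC (by omega)
  obtain ⟨d, hdD, hd⟩ := Submodule.exists_incongruent_family (m := κ) hLD (by omega)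
  -- Only `ψ 1 ≠ 1` is known, so `l` is rescaled to make the pairing equal to `1`; subspaces allow
  -- this.
  have hscale : ∀ l w : V, B l w ≠ 0 → ψ (B ((B l w)⁻¹ • l) w) ≠ 1 := by
    intro l w h
    rw [map_smul, LinearMap.smul_apply, smul_eq_mul, inv_mul_cancel₀ h]
    exact hψ
  obtain ⟨x, hx, hM⟩ := hW.exists_unit_eigenvector {m | m ∈ LC ∨ m ∈ LD} (by
    rintro u (hu | hu) v (hv | hv)
    · rw [(hLCmem v (hLC hv)).1 hv u hu, AddChar.map_zero_eq_one]
    · rw [hCD u (hLC hu) v (hLD hv), AddChar.map_zero_eq_one]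
    · rw [hDC u (hLD hu) v (hLC hv), AddChar.map_zero_eq_one]
    · rw [(hLDmem v (hLD hv)).1 hv u hu, AddChar.map_zero_eq_one])
  let w : Fin (Nat.card K ^ κ) × Fin (Nat.card K ^ r) → (Fin n → Fin (Nat.card K)) → ℂ :=
    fun p => W (d p.1) *ᵥ (W (c p.2) *ᵥ x)
  have hzero : ∀ (l v : V) (p p' : Fin (Nat.card K ^ κ) × Fin (Nat.card K ^ r)),
      (l ∈ LC ∨ l ∈ LD) → B l (v + d p'.1 + c p'.2 - d p.1 - c p.2) ≠ 0 →
        star (w p) ⬝ᵥ (W v *ᵥ w p') = 0 := by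
    intro l v p p' hl hne
    obtain ⟨μ, hμ⟩ := hM ((B l (v + d p'.1 + c p'.2 - d p.1 - c p.2))⁻¹ • l)
      (hl.imp (LC.smul_mem _) (LD.smul_mem _))
    exact hW.dotProduct_mulVec_eq_zero hx hμ (hscale _ _ hne)
  have hzeroD : ∀ v ∈ C, ∀ p p', p.1 ≠ p'.1 → star (w p) ⬝ᵥ (W v *ᵥ w p') = 0 := by
    intro v hv p p' hp
    -- Since `LD` is its own orthogonal inside `D`, some `l ∈ LD` separates the two representatives;
    -- it pairs to zero with everything from `C`.
    have hmem : d p'.1 - d p.1 ∉ LD := fun h => hp (hd _ _ h).symm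
    rw [hLDmem _ (D.sub_mem (hdD _) (hdD _))] at hmem
    push Not at hmem
    obtain ⟨l, hl, hne⟩ := hmem
    refine hzero l v p p' (Or.inr hl) ?_
    rw [map_sub] at hne
    simpa [hDC l (hLD hl) _ hv, hDC l (hLD hl) _ (hcC _)] using hne
  have hzeroC : ∀ p p', p.2 ≠ p'.2 → star (w p) ⬝ᵥ (W 0 *ᵥ w p') = 0 := by
    intro p p' hp
    have hmem : c p'.2 - c p.2 ∉ LC := fun h => hp (hc _ _ h).symm
    rw [hLCmem _ (C.sub_mem (hcC _) (hcC _))] at hmem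
    push Not at hmem
    obtain ⟨l, hl, hne⟩ := hmem
    refine hzero l 0 p p' (Or.inl hl) ?_
    rw [map_sub] at hne
    simpa [hCD l (hLC hl) _ (hdD _)] using hne
  refine ⟨⟨Matrix.of fun i p => w p i, ?_⟩, ?_⟩
  · ext p p'
    rw [← Matrix.mul_one ((Matrix.of fun i p => w p i)ᴴ),
      Matrix.conjTranspose_mul_mul_of_apply, ← hW.zero]
    rcases eq_or_ne p p' with rfl | hp
    · rw [hW.zero, Matrix.one_mulVec, hW.dotProduct_mulVec, hW.dotProduct_mulVec, hx,
        Matrix.one_apply_eq]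
    · rw [Matrix.one_apply_ne hp]
      by_cases h1 : p.1 = p'.1
      · exact hzeroC p p' fun h2 => hp (Prod.ext h1 h2)
      · exact hzeroD 0 C.zero_mem p p' h1
  · rintro v (hv | hv)
    · refine ⟨Matrix.of fun j j' => star (W (c j) *ᵥ x) ⬝ᵥ (W v *ᵥ (W (c j') *ᵥ x)), ?_⟩
      ext ⟨a, j⟩ ⟨a', j'⟩
      rw [Matrix.conjTranspose_mul_mul_of_apply, Matrix.kroneckerMap_apply, Matrix.one_apply]
      split_ifs with h
      · subst h
        have hcomm : W v * W (d a) = W (d a) * W v := by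
          rw [hW.comm, hCD v hv _ (hdD a), AddChar.map_zero_eq_one, one_smul]
        change star (W (d a) *ᵥ (W (c j) *ᵥ x)) ⬝ᵥ
          (W v *ᵥ (W (d a) *ᵥ (W (c j') *ᵥ x))) = _
        rw [Matrix.mulVec_mulVec (W (c j') *ᵥ x), hcomm, ← Matrix.mulVec_mulVec,
          hW.dotProduct_mulVec, one_mul, Matrix.of_apply]
      · rw [zero_mul]
        exact hzeroD v hv _ _ h
    -- Some `l` in the hull pairs nontrivially with `v` but trivially with all labels, so every
    -- matrix entry of the compression vanishes.
    · refine ⟨0, ?_⟩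
      rw [Matrix.kronecker_zero]
      ext p p'
      rw [Matrix.conjTranspose_mul_mul_of_apply, Matrix.zero_apply]
      rw [LinearMap.BilinForm.mem_orthogonal_iff] at hv
      push Not at hv
      obtain ⟨l, hl, hne⟩ := hv
      refine hzero l v p p' (Or.inl (hHLC hl)) ?_
      simpa [hCD l hl.1 _ (hdD _), hDC l hl.2 _ (hcC _)] using hne

namespace SubsystemCode

variable {q n κ r : ℕ} {Q : SubsystemCode q n κ r}

theorem Detects.smul {E : Matrix (Fin n → Fin q) (Fin n → Fin q) ℂ} (h : Q.Detects E) (c : ℂ) :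
    Q.Detects (c • E) := by
  obtain ⟨M, hM⟩ := h
  refine ⟨c • M, ?_⟩
  rw [Matrix.mul_smul, Matrix.smul_mul, hM, Matrix.kronecker_smul]

theorem Detects.sum {ι : Type*} (s : Finset ι)
    {E : ι → Matrix (Fin n → Fin q) (Fin n → Fin q) ℂ} (h : ∀ i ∈ s, Q.Detects (E i)) :
    Q.Detects (∑ i ∈ s, E i) := by
  classical
  induction s using Finset.induction_on with
  | empty => exact ⟨0, by simp⟩
  | insert j s hj ih =>
    obtain ⟨M, hM⟩ := h j (Finset.mem_insert_self j s)
    obtain ⟨N, hN⟩ := ih fun i hi => h i (Finset.mem_insert_of_mem hi)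
    refine ⟨M + N, ?_⟩
    rw [Finset.sum_insert hj, Matrix.mul_add, Matrix.add_mul, hM, hN, Matrix.kronecker_add]

end SubsystemCode

/-! ### Weyl operators as an error basis -/

section Weyl

variable {K ι : Type*} [Field K] {q : ℕ}

/-- Translation of a basis label by a vector over `K`, along a labelling `e` of `K`. -/
def qShift (e : Fin q ≃ K) (a : ι → K) (y : ι → Fin q) : ι → Fin q :=
  fun i => e.symm (e (y i) + a i)

theorem eq_qShift_iff {e : Fin q ≃ K} {a : ι → K} {x y : ι → Fin q} :
    x = qShift e a y ↔ ∀ i, e (x i) = e (y i) + a i := by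
  simp [funext_iff, qShift, Equiv.eq_symm_apply]

theorem qShift_qShift (e : Fin q ≃ K) (a b : ι → K) (y : ι → Fin q) :
    qShift e a (qShift e b y) = qShift e (a + b) y := by
  ext i
  simp [qShift, add_assoc, add_comm (b i)]

theorem qShift_injective (e : Fin q ≃ K) (a : ι → K) :
    Function.Injective (qShift (ι := ι) e a) := by
  intro x y h
  funext i
  simpa [qShift] using congrFun h i

variable [Fintype ι]

/-- The Weyl operator `X(a) Z(b)` on qudits labelled by `ι`. -/
def weylMatrix (ψ : AddChar K ℂ) (e : Fin q ≃ K) (a b : ι → K) :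
    Matrix (ι → Fin q) (ι → Fin q) ℂ :=
  Matrix.of fun x y => if x = qShift e a y then ψ (∑ i, b i * e (y i)) else 0

variable (ψ : AddChar K ℂ) (e : Fin q ≃ K)

theorem weylMatrix_apply (a b : ι → K) (x y : ι → Fin q) :
    weylMatrix ψ e a b x y = if x = qShift e a y then ψ (∑ i, b i * e (y i)) else 0 :=
  rfl

theorem weylMatrix_zero : weylMatrix ψ e (0 : ι → K) 0 = 1 := by
  ext x y
  have : qShift e 0 y = y := by ext i; simp [qShift]
  simp [weylMatrix_apply, this, Matrix.one_apply]

variable [DecidableEq ι]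

theorem weylMatrix_mul (a b a' b' : ι → K) :
    weylMatrix ψ e a b * weylMatrix ψ e a' b' =
      ψ (∑ i, b i * a' i) • weylMatrix ψ e (a + a') (b + b') := by
  ext x y
  rw [Matrix.mul_apply, Matrix.smul_apply]
  simp only [weylMatrix_apply, mul_ite, mul_zero, Finset.sum_ite_eq', Finset.mem_univ, if_true,
    qShift_qShift, smul_eq_mul, ite_mul, zero_mul]
  congr 1
  rw [← AddChar.map_add_eq_mul, ← AddChar.map_add_eq_mul, ← Finset.sum_add_distrib,
    ← Finset.sum_add_distrib]
  congr 1
  refine Finset.sum_congr rfl fun i _ => ?_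
  simp only [qShift, Equiv.apply_symm_apply, Pi.add_apply]
  ring

theorem weylMatrix_unitary [Finite K] (a b : ι → K) :
    (weylMatrix ψ e a b)ᴴ * weylMatrix ψ e a b = 1 := by
  ext x y
  rw [Matrix.mul_apply, Matrix.one_apply]
  simp only [weylMatrix_apply, mul_ite, mul_zero, Finset.sum_ite_eq', Finset.mem_univ, if_true,
    Matrix.conjTranspose_apply, (qShift_injective e a).eq_iff, eq_comm (a := y)]
  split_ifs with h
  · subst h
    change (starRingEnd ℂ) _ * _ = _
    rw [← AddChar.map_neg_eq_conj, ← AddChar.map_add_eq_mul, neg_add_cancel,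
      AddChar.map_zero_eq_one]
  · simp

theorem isWeylSystem_weylMatrix [Finite K] {V : Type*} [AddCommGroup V] (α β : V →+ (ι → K)) :
    IsWeylSystem (fun v => weylMatrix ψ e (α v) (β v))
      (fun u v => ψ (∑ i, (β u i * α v i - α u i * β v i))) where
  zero := by simp only [map_zero, weylMatrix_zero]
  mul u v := ⟨ψ (∑ i, β u i * α v i), (ψ.val_isUnit _).ne_zero, by rw [weylMatrix_mul, map_add, map_add]⟩
  comm u v := by
    rw [weylMatrix_mul, weylMatrix_mul, smul_smul, ← AddChar.map_add_eq_mul,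
      ← Finset.sum_add_distrib, add_comm (α u), add_comm (β u)]
    congr 2
    exact Finset.sum_congr rfl fun i _ => by ring
  unitary u := weylMatrix_unitary ψ e _ _

/-- Orthogonality of characters: if `t i ≠ 0`, the character takes the value `ψ 1 ≠ 1` at the vector
with single entry `(t i)⁻¹`. -/
theorem AddChar.sum_apply_dotProduct [Fintype K] [DecidableEq K] {ψ : AddChar K ℂ}
    (hψ : ψ 1 ≠ 1) (t : ι → K) :
    ∑ b : ι → K, ψ (∑ i, b i * t i) = if t = 0 then (Fintype.card (ι → K) : ℂ) else 0 := by
  classical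
  let g : (ι → K) →+ K :=
    { toFun := fun b => ∑ i, b i * t i
      map_zero' := by simp
      map_add' := fun b b' => by simp [add_mul, Finset.sum_add_distrib] }
  have h := AddChar.sum_eq_ite (ψ.compAddMonoidHom g)
  have hiff : ψ.compAddMonoidHom g = 0 ↔ t = 0 := by
    constructor
    · intro h0
      by_contra ht
      obtain ⟨i, hi⟩ := Function.ne_iff.1 ht
      have h1 := congrArg (fun φ : AddChar (ι → K) ℂ => φ (Pi.single i (t i)⁻¹)) h0
      simp only [AddChar.compAddMonoidHom_apply, AddChar.zero_apply] at h1
      have h2 : g (Pi.single i (t i)⁻¹) = 1 := by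
        change ∑ j, (Pi.single i (t i)⁻¹ : ι → K) j * t j = 1
        rw [Finset.sum_eq_single i (fun j _ hj => by simp [hj]) (by simp)]
        simp [inv_mul_cancel₀ (show t i ≠ 0 from hi)]
      rw [h2] at h1
      exact hψ h1
    · rintro rfl
      ext b
      simp [g]
  simp only [hiff] at h
  exact h

end Weyl

/-- Extension of a vector on `T` by zero. -/
def extendZero {ι K : Type*} [DecidableEq ι] [Zero K] (T : Finset ι) (a : T → K) (i : ι) : K :=
  if h : i ∈ T then a ⟨i, h⟩ else 0

theorem sum_extendZero_mul {ι K : Type*} [DecidableEq ι] [Fintype ι] [Semiring K]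
    (T : Finset ι) (a : T → K) (f : ι → K) :
    ∑ i, extendZero T a i * f i = ∑ i : T, a i * f i := by
  rw [← Finset.sum_subset (Finset.subset_univ T)
    (fun i _ hi => by rw [extendZero, dif_neg hi, zero_mul]), ← Finset.sum_coe_sort T]
  exact Finset.sum_congr rfl fun i _ => by rw [extendZero, dif_pos i.2]

/-- Operators that act on `T` are combinations of the Weyl operators supported on `T`. -/
theorem ActsOn.exists_eq_sum_weylMatrix {K : Type*} [Field K] [Fintype K] {q n : ℕ}
    {ψ : AddChar K ℂ} (hψ : ψ 1 ≠ 1) (e : Fin q ≃ K) {T : Finset (Fin n)}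
    {E : Matrix (Fin n → Fin q) (Fin n → Fin q) ℂ} (hE : ActsOn T E) :
    ∃ c : (T → K) × (T → K) → ℂ,
      E = ∑ p, c p • weylMatrix ψ e (extendZero T p.1) (extendZero T p.2) := by
  classical
  obtain ⟨f, hf⟩ := hE
  let N : ℂ := Fintype.card (T → K)
  have hN : N ≠ 0 := Nat.cast_ne_zero.2 Fintype.card_ne_zero
  -- Fourier inversion: for each shift `p.1`, the function `z ↦ f (z + p.1) z` is expanded in the
  -- characters of `T → K`.
  refine ⟨fun p => N⁻¹ * ∑ z : T → Fin q, f (qShift e p.1 z) z * ψ (-∑ i, p.2 i * e (z i)), ?_⟩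
  ext x y
  rw [Matrix.sum_apply, Fintype.sum_prod_type]
  simp only [Matrix.smul_apply, weylMatrix_apply, sum_extendZero_mul, smul_eq_mul]
  by_cases hxy : ∀ i ∉ T, x i = y i
  · rw [(hf x y).1 hxy]
    let a₀ : T → K := fun i => e (x i) - e (y i)
    have hiff : ∀ a : T → K, x = qShift e (extendZero T a) y ↔ a = a₀ := by
      intro a
      rw [eq_qShift_iff]
      constructor
      · intro h
        ext i
        have := h i
        rw [extendZero, dif_pos i.2] at this
        simp [a₀, this]
      · rintro rfl i
        by_cases hi : i ∈ T
        · simp [extendZero, hi, a₀]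
        · simp [extendZero, hi, hxy i hi]
    have hx : (fun i : T => x i) = qShift e a₀ (fun i : T => y i) := by
      rw [eq_qShift_iff]
      simp [a₀]
    simp only [hiff, mul_ite, mul_zero]
    rw [Finset.sum_comm]
    simp only [Finset.sum_ite_eq', Finset.mem_univ, if_true]
    simp only [mul_assoc, ← Finset.mul_sum, Finset.sum_mul]
    rw [Finset.sum_comm]
    have hterm : ∀ z : T → Fin q,
        ∑ b : T → K, f (qShift e a₀ z) z * (ψ (-∑ i, b i * e (z i)) * ψ (∑ i, b i * e (y i))) =
          if z = (fun i : T => y i) then f (qShift e a₀ z) z * N else 0 := by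
      intro z
      rw [← Finset.mul_sum]
      have h1 : ∀ b : T → K, ψ (-∑ i, b i * e (z i)) * ψ (∑ i, b i * e (y i)) =
          ψ (∑ i, b i * (e (y i) - e (z i))) := by
        intro b
        rw [← AddChar.map_add_eq_mul]
        congr 1
        simp only [mul_sub, Finset.sum_sub_distrib]
        ring
      simp only [h1]
      rw [AddChar.sum_apply_dotProduct hψ (fun i : T => e (y i) - e (z i))]
      have h2 : ((fun i : T => e (y i) - e (z i)) = 0) ↔ z = fun i : T => y i := by
        simp only [funext_iff, Pi.zero_apply, sub_eq_zero, e.injective.eq_iff]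
        exact forall_congr' fun i => eq_comm
      simp only [h2, mul_ite, mul_zero]
      rfl
    simp only [hterm, Finset.sum_ite_eq', Finset.mem_univ, if_true]
    rw [← hx]
    field_simp
  · rw [(hf x y).2 hxy]
    symm
    refine Finset.sum_eq_zero fun a _ => Finset.sum_eq_zero fun b _ => ?_
    rw [if_neg, mul_zero]
    rw [eq_qShift_iff]
    intro h
    refine hxy fun i hi => e.injective ?_
    simpa [extendZero, hi] using h i

/-! ### From the Hermitian form to a symplectic form -/

theorem Submodule.finrank_restrictScalars {K F V : Type*} [Field K] [Field F] [Algebra K F]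
    [AddCommGroup V] [Module F V] [Module K V] [IsScalarTower K F V] {m : ℕ}
    (hm : Module.finrank K F = m) (U : Submodule F V) :
    Module.finrank K (U.restrictScalars K) = m * Module.finrank F U := by
  rw [← hm]
  exact (Module.finrank_mul_finrank K F U).symm

section QuadraticExtension

variable {K F : Type*} [Field K] [Field F] [Algebra K F]

/-- The Hermitian form on `F ^ n` composed with a functional `β` on `F`, written in coordinates. -/
def symplecticForm (α β : F →ₗ[K] K) (n : ℕ) : LinearMap.BilinForm K (Fin n → F) :=
  LinearMap.mk₂ K (fun u v => ∑ i, (β (u i) * α (v i) - α (u i) * β (v i)))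
    (fun u u' v => by
      rw [← Finset.sum_add_distrib]
      exact Finset.sum_congr rfl fun i _ => by simp only [Pi.add_apply, map_add]; ring)
    (fun c u v => by
      rw [smul_eq_mul, Finset.mul_sum]
      exact Finset.sum_congr rfl fun i _ => by
        simp only [Pi.smul_apply, map_smul, smul_eq_mul]; ring)
    (fun u v v' => by
      rw [← Finset.sum_add_distrib]
      exact Finset.sum_congr rfl fun i _ => by simp only [Pi.add_apply, map_add]; ring)
    (fun c u v => by
      rw [smul_eq_mul, Finset.mul_sum]
      exact Finset.sum_congr rfl fun i _ => by
        simp only [Pi.smul_apply, map_smul, smul_eq_mul]; ring)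

theorem symplecticForm_apply (α β : F →ₗ[K] K) (n : ℕ) (u v : Fin n → F) :
    symplecticForm α β n u v = ∑ i, (β (u i) * α (v i) - α (u i) * β (v i)) :=
  rfl

theorem symplecticForm_isAlt (α β : F →ₗ[K] K) (n : ℕ) : (symplecticForm α β n).IsAlt := by
  intro u
  rw [symplecticForm_apply]
  exact Finset.sum_eq_zero fun i _ => by ring

variable [Fintype K]

/-- Coordinates on the quadratic extension `F` of the finite field `K`, in which the second
coordinate of `u * v ^ |K|` is the standard symplectic form. -/
theorem FiniteField.exists_symplectic_coordinates [Finite F] (h2 : Module.finrank K F = 2) :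
    ∃ α β : F →ₗ[K] K, (∀ a b, ∃ z, α z = a ∧ β z = b) ∧
      ∀ u v, β (u * v ^ Fintype.card K) = β u * α v - α u * β v := by
  obtain ⟨γ, hγ⟩ : ∃ γ : F, ∀ a : K, a • (1 : F) ≠ γ := by
    by_contra! h
    have := finrank_le_one (1 : F) h
    omega
  have hli : LinearIndependent K ![(1 : F), γ] :=
    (LinearIndependent.pair_iff' one_ne_zero).2 hγ
  let b := basisOfLinearIndependentOfCardEqFinrank hli (by simp [h2])
  have hb0 : b 0 = 1 := by simp [b]
  have hb1 : b 1 = γ := by simp [b]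
  have hα1 : b.coord 0 1 = 1 := by rw [← hb0]; simp
  have hβ1 : b.coord 1 1 = 0 := by rw [← hb0]; simp
  have hαγ : b.coord 0 γ = 0 := by rw [← hb1]; simp
  have hβγ : b.coord 1 γ = 1 := by rw [← hb1]; simp
  refine ⟨b.coord 0, b.coord 1, fun x y => ⟨x • 1 + y • γ, ?_, ?_⟩, fun u v => ?_⟩
  · simp only [map_add, map_smul, hα1, hαγ, smul_eq_mul, mul_one, mul_zero, add_zero]
  · simp only [map_add, map_smul, hβ1, hβγ, smul_eq_mul, mul_one, mul_zero, zero_add]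
  · have hrepr : ∀ z : F, z = b.coord 0 z • 1 + b.coord 1 z • γ := by
      intro z
      conv_lhs => rw [← b.sum_repr z, Fin.sum_univ_two, hb0, hb1]
      rfl
    -- Trace and norm put `γ + γ ^ |K|` and `γ * γ ^ |K|` in `K`. Eliminating `γ ^ |K|` from the
    -- product leaves `y * x' - x * y'` as the coefficient of `γ`.
    have htr := FiniteField.algebraMap_trace_eq_sum_pow K F γ
    have hnorm := FiniteField.algebraMap_norm_eq_prod_pow K F γ
    rw [h2, Finset.sum_range_succ, Finset.sum_range_one, pow_zero, pow_one, pow_one,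
      Nat.card_eq_fintype_card] at htr
    rw [h2, Finset.prod_range_succ, Finset.prod_range_one, pow_zero, pow_one, pow_one,
      Nat.card_eq_fintype_card] at hnorm
    generalize Algebra.trace K F γ = t at htr
    generalize Algebra.norm K γ = m at hnorm
    generalize hx : b.coord 0 u = x
    generalize hy : b.coord 1 u = y
    generalize hx' : b.coord 0 v = x'
    generalize hy' : b.coord 1 v = y'
    have hv : v ^ Fintype.card K = x' • 1 + y' • γ ^ Fintype.card K := by
      change FiniteField.frobeniusAlgHom K F v = x' • 1 + y' • FiniteField.frobeniusAlgHom K F γ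
      conv_lhs => rw [hrepr v, hx', hy']
      rw [map_add, map_smul, map_smul, map_one]
    have hprod : u * v ^ Fintype.card K =
        (x * x' + x * y' * t + y * y' * m) • (1 : F) + (y * x' - x * y') • γ := by
      rw [hv, hrepr u, hx, hy]
      simp only [Algebra.smul_def, map_add, map_mul, map_sub, htr, hnorm]
      ring
    rw [hprod, map_add, map_smul, map_smul, hβ1, hβγ]
    simp

variable {α β : F →ₗ[K] K} {n : ℕ}

theorem symplecticForm_eq_sum (hform : ∀ u v, β (u * v ^ Fintype.card K) = β u * α v - α u * β v)
    (u v : Fin n → F) :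
    symplecticForm α β n u v = β (∑ i, u i * v i ^ Fintype.card K) := by
  rw [symplecticForm_apply, map_sum]
  exact Finset.sum_congr rfl fun i _ => (hform _ _).symm

theorem restrictScalars_hermitianDual [Finite F] (h2 : Module.finrank K F = 2)
    (hsurj : ∀ a b, ∃ z, α z = a ∧ β z = b)
    (hform : ∀ u v, β (u * v ^ Fintype.card K) = β u * α v - α u * β v)
    (U : Submodule F (Fin n → F)) :
    (hermitianDual (Fintype.card K) U).restrictScalars K =
      (symplecticForm α β n).orthogonal (U.restrictScalars K) := by
  ext v
  constructor
  · intro hv u hu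
    refine (symplecticForm_isAlt α β n).isRefl _ _ ?_
    rw [symplecticForm_eq_sum hform]
    exact (congrArg β (hv u hu)).trans (map_zero β)
  · intro hv u hu
    by_contra hz
    obtain ⟨γ, -, hγ⟩ := hsurj 0 1
    set z := ∑ i, v i * u i ^ Fintype.card K with hzdef
    -- `U` is closed under `F`-scalars. Scaling `u` by `c` multiplies the Hermitian product by `c ^
    -- |K|`, and `x ^ (|K| ^ 2) = x` on `F`, so this `c` turns `z` into `γ`, where `β` is `1`.
    have hcU : (γ / z) ^ Fintype.card K • u ∈ U := U.smul_mem _ hu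
    have h0 := (symplecticForm_isAlt α β n).isRefl _ _ (hv _ hcU)
    rw [symplecticForm_eq_sum hform] at h0
    have hsum : ∑ i, v i * ((γ / z) ^ Fintype.card K • u) i ^ Fintype.card K = γ := by
      have hcard : ((γ / z) ^ Fintype.card K) ^ Fintype.card K = γ / z := by
        rw [← pow_mul, ← sq]
        have : Fintype F := Fintype.ofFinite F
        rw [← h2, ← Module.card_eq_pow_finrank (K := K) (V := F), FiniteField.pow_card]
      have h1 : ∀ i, v i * ((γ / z) ^ Fintype.card K • u) i ^ Fintype.card K =
          γ / z * (v i * u i ^ Fintype.card K) := by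
        intro i
        rw [Pi.smul_apply, smul_eq_mul, mul_pow, hcard]
        ring
      rw [Finset.sum_congr rfl fun i _ => h1 i, ← Finset.mul_sum, ← hzdef,
        div_mul_cancel₀ _ hz]
    rw [hsum, hγ] at h0
    exact one_ne_zero h0

theorem symplecticForm_nondegenerate [Finite F] (h2 : Module.finrank K F = 2)
    (hsurj : ∀ a b, ∃ z, α z = a ∧ β z = b)
    (hform : ∀ u v, β (u * v ^ Fintype.card K) = β u * α v - α u * β v) :
    (symplecticForm α β n).Nondegenerate := by
  refine (symplecticForm_isAlt α β n).isRefl.nondegenerate_iff_separatingRight.2 fun v hv => ?_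
  have hmem : v ∈ (hermitianDual (Fintype.card K) ⊤).restrictScalars K := by
    rw [restrictScalars_hermitianDual h2 hsurj hform]
    exact fun u _ => hv u
  funext i
  have h := hmem (Pi.single i 1) trivial
  rwa [Finset.sum_eq_single i
    (fun j _ hj => by rw [Pi.single_eq_of_ne hj, zero_pow Fintype.card_ne_zero, mul_zero])
    (by simp), Pi.single_eq_same, one_pow, mul_one] at h

end QuadraticExtension

/-! ### Subsystem codes from linear codes -/

/-- The Clifford subsystem code of a linear code detects every error of weight less than `d` if
every vector of the Hermitian dual of the hull outside the code has weight at least `d`. -/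
theorem SubsystemCode.exists_of_code {F : Type*} [Field F] [Fintype F] [DecidableEq F]
    {q n κ r d : ℕ} (hq : Fintype.card F = q ^ 2) (C : Submodule F (Fin n → F))
    (hκ : κ + Module.finrank F C + Module.finrank F (hermitianHull q C) = n)
    (hr : r + Module.finrank F (hermitianHull q C) = Module.finrank F C)
    (hd : ∀ v ∈ hermitianDual q (hermitianHull q C), v ∉ C → d ≤ hammingNorm v) :
    ∃ Q : SubsystemCode q n κ r, Q.DistanceAtLeast d := by
  obtain ⟨K, hK, h2⟩ := exists_subfield_card_eq hq
  have : Fintype K := Fintype.ofFinite K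
  have hK' : Fintype.card K = q := by rw [← Nat.card_eq_fintype_card, hK]
  obtain ⟨α, β, hsurj, hform⟩ := FiniteField.exists_symplectic_coordinates h2
  obtain ⟨ψ, hψ⟩ := AddChar.exists_apply_ne_zero.2 (one_ne_zero : (1 : K) ≠ 0)
  let B := symplecticForm α β n
  have hB : B.IsAlt := symplecticForm_isAlt α β n
  have hdual : ∀ U : Submodule F (Fin n → F), (hermitianDual q U).restrictScalars K =
      B.orthogonal (U.restrictScalars K) := by
    intro U
    rw [← hK']
    exact restrictScalars_hermitianDual h2 hsurj hform U
  have hBn : B.Nondegenerate := symplecticForm_nondegenerate h2 hsurj hform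
  have hhull : (hermitianHull q C).restrictScalars K =
      C.restrictScalars K ⊓ B.orthogonal (C.restrictScalars K) := by
    rw [← hdual]
    rfl
  have hdim (U : Submodule F (Fin n → F)) := U.finrank_restrictScalars h2
  have hdimV : Module.finrank K (Fin n → F) = 2 * n := by
    rw [← Module.finrank_mul_finrank K F (Fin n → F), h2, Module.finrank_fin_fun]
  let αn : (Fin n → F) →+ (Fin n → K) := α.toAddMonoidHom.compLeft (Fin n)
  let βn : (Fin n → F) →+ (Fin n → K) := β.toAddMonoidHom.compLeft (Fin n)
  let e : Fin q ≃ K := (Finite.equivFinOfCardEq hK).symm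
  have hW := isWeylSystem_weylMatrix ψ e αn βn
  obtain ⟨Q, hQ⟩ := SubsystemCode.exists_of_weyl (n := n) (κ := κ) (r := r) hK hψ hB hW
    (C.restrictScalars K)
    (by rw [LinearMap.BilinForm.orthogonal_orthogonal hBn hB.isRefl, inf_comm])
    (by rw [← hhull, hdim, hdim]; omega)
    (by rw [← hhull, LinearMap.BilinForm.finrank_orthogonal hBn, hdimV, hdim, hdim]; omega)
  refine ⟨Q, fun T hT E hE => ?_⟩
  obtain ⟨c, rfl⟩ := hE.exists_eq_sum_weylMatrix hψ e
  refine Detects.sum _ fun p _ => Detects.smul ?_ _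
  choose g hgα hgβ using hsurj
  -- The preimage `g 0 0` is an arbitrary choice and might be nonzero, so `v` is set to zero off `T`
  -- by hand to keep its weight at most `T.card`.
  let v : Fin n → F := fun i =>
    if i ∈ T then g (extendZero T p.1 i) (extendZero T p.2 i) else 0
  have hvα : αn v = extendZero T p.1 := by
    funext i
    change α (v i) = _
    by_cases hi : i ∈ T
    · simp only [v, if_pos hi, hgα]
    · simp only [v, if_neg hi, map_zero, extendZero, dif_neg hi]
  have hvβ : βn v = extendZero T p.2 := by
    funext i
    change β (v i) = _
    by_cases hi : i ∈ T
    · simp only [v, if_pos hi, hgβ]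
    · simp only [v, if_neg hi, map_zero, extendZero, dif_neg hi]
  have hwt : hammingNorm v < d := by
    refine lt_of_le_of_lt (Finset.card_le_card fun i hi => ?_) hT
    by_contra hiT
    exact (Finset.mem_filter.1 hi).2 (if_neg hiT)
  have := hQ v ?_
  · rwa [hvα, hvβ] at this
  · rw [← hhull, ← hdual]
    by_contra! h
    exact absurd (hd v h.2 h.1) (by omega)

/-- A subsystem code with trivial gauge subsystem may be split into an information subsystem and a
gauge subsystem. -/
theorem SubsystemCode.DistanceAtLeast.exists_split {q n κ r d : ℕ}
    {Q : SubsystemCode q n (κ + r) 0} (hQ : Q.DistanceAtLeast d) :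
    ∃ Q' : SubsystemCode q n κ r, Q'.DistanceAtLeast d := by
  let g : Fin (q ^ κ) × Fin (q ^ r) ≃ Fin (q ^ (κ + r)) × Fin (q ^ 0) :=
    (finProdFinEquiv.trans (finCongr (pow_add q κ r).symm)).trans
      ((Equiv.prodUnique _ (Fin 1)).symm.trans
        (Equiv.prodCongr (Equiv.refl _) (finCongr (pow_zero q).symm)))
  have : Subsingleton (Fin (q ^ 0)) := by
    rw [pow_zero]; infer_instance
  refine ⟨⟨Q.embed.submatrix id g, ?_⟩, fun T hT E hE => ?_⟩
  · change (Q.embedᴴ * Q.embed).submatrix g g = 1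
    rw [Q.isometry, Matrix.submatrix_one_equiv]
  · obtain ⟨M, hM⟩ := hQ T hT E hE
    let j : Fin (q ^ 0) := ⟨0, by simp⟩
    -- The gauge factor of `Q` has dimension one, so the compression is a scalar, and a scalar has
    -- the form `1 ⊗ M` for any splitting.
    refine ⟨M j j • 1, ?_⟩
    rw [Matrix.kronecker_smul, Matrix.one_kronecker_one]
    have h1 : (Q.embed.submatrix id g)ᴴ * E * Q.embed.submatrix id g =
        (Q.embedᴴ * E * Q.embed).submatrix g g := rfl
    rw [h1, hM]
    ext p p'
    rw [Matrix.submatrix_apply, Matrix.kroneckerMap_apply, Matrix.smul_apply, Matrix.one_apply,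
      Matrix.one_apply, Subsingleton.elim (g p).2 j, Subsingleton.elim (g p').2 j]
    have h2 : (g p).1 = (g p').1 ↔ p = p' := by
      refine ⟨fun h => g.injective (Prod.ext h (Subsingleton.elim _ _)), fun h => by rw [h]⟩
    simp only [h2, ite_mul, one_mul, zero_mul, smul_eq_mul, mul_ite, mul_one, mul_zero]

/-! ### Puncturing and shortening -/

section PunctureShorten

variable {F : Type*} [Field F] {n : ℕ}

/-- Deletion of the coordinate `i`. -/
def punctureMap (F : Type*) [Field F] {n : ℕ} (i : Fin (n + 1)) :
    (Fin (n + 1) → F) →ₗ[F] (Fin n → F) :=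
  LinearMap.funLeft F F i.succAbove

/-- Insertion of a zero at the coordinate `i`. -/
def insertZeroMap (F : Type*) [Field F] {n : ℕ} (i : Fin (n + 1)) :
    (Fin n → F) →ₗ[F] (Fin (n + 1) → F) where
  toFun v := i.insertNth 0 v
  map_add' u v := by
    funext j
    cases j using i.succAboveCases <;> simp
  map_smul' c v := by
    funext j
    cases j using i.succAboveCases <;> simp

@[simp]
theorem punctureMap_apply (i : Fin (n + 1)) (u : Fin (n + 1) → F) (j : Fin n) :
    punctureMap F i u j = u (i.succAbove j) :=
  rfl

@[simp]
theorem insertZeroMap_apply_same (i : Fin (n + 1)) (v : Fin n → F) :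
    insertZeroMap F i v i = 0 :=
  Fin.insertNth_apply_same (α := fun _ => F) i 0 v

@[simp]
theorem insertZeroMap_apply_succAbove (i : Fin (n + 1)) (v : Fin n → F) (j : Fin n) :
    insertZeroMap F i v (i.succAbove j) = v j :=
  Fin.insertNth_apply_succAbove (α := fun _ => F) i 0 v j

@[simp]
theorem punctureMap_insertZeroMap (i : Fin (n + 1)) (v : Fin n → F) :
    punctureMap F i (insertZeroMap F i v) = v := by
  ext j
  simp

theorem insertZeroMap_punctureMap {i : Fin (n + 1)} {u : Fin (n + 1) → F} (hu : u i = 0) :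
    insertZeroMap F i (punctureMap F i u) = u := by
  funext j
  cases j using i.succAboveCases <;> simp [hu]

theorem insertZeroMap_injective (i : Fin (n + 1)) : Function.Injective (insertZeroMap F i) :=
  Function.LeftInverse.injective (punctureMap_insertZeroMap i)

theorem hammingNorm_le_hammingNorm_punctureMap_add_one [DecidableEq F] (i : Fin (n + 1))
    (u : Fin (n + 1) → F) : hammingNorm u ≤ hammingNorm (punctureMap F i u) + 1 := by
  classical
  have hsub : Finset.univ.filter (fun j => u j ≠ 0) ⊆
      insert i ((Finset.univ.filter fun j => punctureMap F i u j ≠ 0).image i.succAbove) := by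
    intro j hj
    cases j using i.succAboveCases with
    | x => exact Finset.mem_insert_self _ _
    | p j =>
      refine Finset.mem_insert_of_mem (Finset.mem_image_of_mem _ ?_)
      rw [Finset.mem_filter] at hj ⊢
      exact ⟨Finset.mem_univ _, hj.2⟩
  calc hammingNorm u ≤ _ := Finset.card_le_card hsub
    _ ≤ _ := Finset.card_insert_le _ _
    _ ≤ _ := Nat.add_le_add_right Finset.card_image_le 1

/-- The code shortened at the coordinate `i`. -/
def shorten (i : Fin (n + 1)) (H : Submodule F (Fin (n + 1) → F)) : Submodule F (Fin n → F) :=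
  H.comap (insertZeroMap F i)

/-- The shortened code is isomorphic to the kernel of the `i`-th coordinate functional on `H`, which
is nonzero. -/
theorem finrank_shorten {i : Fin (n + 1)} {H : Submodule F (Fin (n + 1) → F)}
    (hi : ∃ h ∈ H, h i ≠ 0) :
    Module.finrank F (shorten i H) + 1 = Module.finrank F H := by
  obtain ⟨h, hH, hi⟩ := hi
  let f : Module.Dual F H := (LinearMap.proj i).domRestrict H
  have hf : f ≠ 0 := fun h0 => hi (congrArg (fun g : Module.Dual F H => g ⟨h, hH⟩) h0)
  rw [← Module.Dual.finrank_ker_add_one_of_ne_zero hf]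
  have hmap : (shorten i H).map (insertZeroMap F i) = (LinearMap.ker f).map H.subtype := by
    ext u
    constructor
    · rintro ⟨v, hv, rfl⟩
      exact ⟨⟨_, hv⟩, insertZeroMap_apply_same i v, rfl⟩
    · rintro ⟨u, hu, rfl⟩
      have hu0 : u.1 i = 0 := hu
      refine ⟨punctureMap F i u.1, ?_, insertZeroMap_punctureMap hu0⟩
      change insertZeroMap F i _ ∈ H
      rw [insertZeroMap_punctureMap hu0]
      exact u.2
  rw [(Submodule.equivMapOfInjective _ (insertZeroMap_injective i) (shorten i H)).finrank_eq,
    hmap, Submodule.finrank_map_subtype_eq]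

theorem finrank_map_punctureMap {i : Fin (n + 1)} {C : Submodule F (Fin (n + 1) → F)}
    (hC : ∀ c ∈ C, punctureMap F i c = 0 → c = 0) :
    Module.finrank F (C.map (punctureMap F i)) = Module.finrank F C := by
  rw [← LinearMap.range_domRestrict]
  refine LinearMap.finrank_range_of_inj ((injective_iff_map_eq_zero _).2 fun c hc => ?_)
  exact Subtype.ext (hC c c.2 hc)

variable {q : ℕ}

theorem sum_mul_pow_succAbove (i : Fin (n + 1)) (u v : Fin (n + 1) → F) :
    ∑ j, u j * v j ^ q =
      u i * v i ^ q + ∑ j, punctureMap F i u j * punctureMap F i v j ^ q :=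
  Fin.sum_univ_succAbove _ i

theorem insertZeroMap_mem_hermitianDual_iff {i : Fin (n + 1)}
    {C : Submodule F (Fin (n + 1) → F)} {v : Fin n → F} :
    insertZeroMap F i v ∈ hermitianDual q C ↔
      v ∈ hermitianDual q (C.map (punctureMap F i)) := by
  constructor
  · rintro h _ ⟨c, hc, rfl⟩
    have := h c hc
    rw [sum_mul_pow_succAbove i] at this
    simpa using this
  · intro h c hc
    rw [sum_mul_pow_succAbove i]
    simpa using h _ ⟨c, hc, rfl⟩

theorem exists_apply_ne_zero_of_finrank_pos {H : Submodule F (Fin n → F)}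
    (hH : 0 < Module.finrank F H) : ∃ i, ∃ h ∈ H, h i ≠ 0 := by
  have : H ≠ ⊥ := by
    rintro rfl
    simp at hH
  obtain ⟨h, hh, h0⟩ := Submodule.exists_mem_ne_zero_of_ne_bot this
  obtain ⟨i, hi⟩ := Function.ne_iff.1 h0
  exact ⟨i, h, hh, hi⟩

variable [Fintype F]

theorem exists_ringHom_eq_pow (hq : Fintype.card F = q ^ 2) : ∃ φ : F →+* F, ∀ x, φ x = x ^ q := by
  obtain ⟨K, hK, -⟩ := exists_subfield_card_eq hq
  have : Fintype K := Fintype.ofFinite K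
  refine ⟨(FiniteField.frobeniusAlgHom K F).toRingHom, fun x => ?_⟩
  rw [← hK, Nat.card_eq_fintype_card]
  rfl

/-- The map `x ↦ x ^ q` is an involutive field automorphism that swaps the arguments of the form, so
orthogonality is symmetric. -/
theorem le_hermitianDual_hermitianDual (hq : Fintype.card F = q ^ 2)
    (C : Submodule F (Fin n → F)) : C ≤ hermitianDual q (hermitianDual q C) := by
  obtain ⟨φ, hφ⟩ := exists_ringHom_eq_pow hq
  intro c hc v hv
  have h := congrArg φ (hv c hc)
  rw [map_sum, map_zero] at h
  rw [← h]
  refine Finset.sum_congr rfl fun i _ => ?_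
  rw [hφ, mul_pow, ← pow_mul, ← sq, ← hq, FiniteField.pow_card, mul_comm]

theorem le_hermitianDual_hermitianHull (hq : Fintype.card F = q ^ 2)
    (C : Submodule F (Fin n → F)) : C ≤ hermitianDual q (hermitianHull q C) :=
  fun _ hc h hh => le_hermitianDual_hermitianDual hq C hc h hh.2

/-- The Hermitian dual of a shortened code is the punctured Hermitian dual. -/
theorem exists_mem_hermitianDual_of_shorten (hq : Fintype.card F = q ^ 2) {i : Fin (n + 1)}
    {H : Submodule F (Fin (n + 1) → F)} (hi : ∃ h ∈ H, h i ≠ 0) {v : Fin n → F}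
    (hv : v ∈ hermitianDual q (shorten i H)) :
    ∃ u ∈ hermitianDual q H, punctureMap F i u = v := by
  obtain ⟨φ, hφ⟩ := exists_ringHom_eq_pow hq
  obtain ⟨g, hgH, hgi⟩ := hi
  -- The missing entry is chosen to make the lift orthogonal to `g`. Every `h ∈ H` is a multiple of
  -- `g` plus a vector `k` vanishing at `i`, which the hypothesis on `v` handles.
  let a : F := -(∑ j, v j * (punctureMap F i g j) ^ q) / g i ^ q
  have hgq : g i ^ q ≠ 0 := pow_ne_zero q hgi
  refine ⟨i.insertNth a v, fun h hh => ?_, by ext j; simp⟩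
  let k := h - (h i / g i) • g
  have hki : k i = 0 := by simp [k, hgi]
  have hkH : k ∈ H := H.sub_mem hh (H.smul_mem _ hgH)
  have hk : punctureMap F i k ∈ shorten i H := by
    change insertZeroMap F i _ ∈ H
    rwa [insertZeroMap_punctureMap hki]
  have h0 := hv _ hk
  have hterm : ∀ j, v j * (punctureMap F i k j) ^ q = v j * (punctureMap F i h j) ^ q -
      (h i ^ q / g i ^ q) * (v j * (punctureMap F i g j) ^ q) := by
    intro j
    have : punctureMap F i k j = punctureMap F i h j - h i / g i * punctureMap F i g j := rfl
    rw [this]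
    simp only [← hφ, map_sub, map_mul, map_div₀]
    ring
  rw [Finset.sum_congr rfl fun j _ => hterm j, Finset.sum_sub_distrib, ← Finset.mul_sum] at h0
  rw [sum_mul_pow_succAbove i]
  have hp : punctureMap F i (i.insertNth a v : Fin (n + 1) → F) = v := by ext j; simp
  rw [hp, Fin.insertNth_apply_same]
  simp only [a]
  rw [sub_eq_zero] at h0
  rw [h0]
  ring

/-- Puncturing a code at a coordinate on which the hull does not vanish shortens the hull. -/
theorem hermitianHull_map_punctureMap (hq : Fintype.card F = q ^ 2) {i : Fin (n + 1)}
    {C : Submodule F (Fin (n + 1) → F)} (hi : ∃ h ∈ hermitianHull q C, h i ≠ 0) :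
    hermitianHull q (C.map (punctureMap F i)) = shorten i (hermitianHull q C) := by
  obtain ⟨h, hh, hi⟩ := hi
  ext v
  constructor
  · rintro ⟨⟨c, hc, rfl⟩, hv⟩
    -- Both `c` and `c` with its `i`-th entry replaced by zero are orthogonal to `h`; hence `c i * h
    -- i ^ q = 0`.
    have hv' := insertZeroMap_mem_hermitianDual_iff.2 hv
    have h1 := hv' h hh.1
    have h2 := le_hermitianDual_hermitianHull hq C hc h hh
    rw [sum_mul_pow_succAbove i] at h1 h2
    simp only [insertZeroMap_apply_same, punctureMap_insertZeroMap, zero_mul, zero_add] at h1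
    rw [h1, add_zero] at h2
    have hci : c i = 0 := (mul_eq_zero.1 h2).resolve_right (pow_ne_zero q hi)
    refine ⟨?_, hv'⟩
    rw [insertZeroMap_punctureMap hci]
    exact hc
  · rintro ⟨hv, hv'⟩
    exact ⟨⟨_, hv, punctureMap_insertZeroMap i v⟩, insertZeroMap_mem_hermitianDual_iff.1 hv'⟩

variable [DecidableEq F]

/-- The dimension survives because a nonzero codeword supported at `i` alone would not be orthogonal
to a hull vector that is nonzero there. A lift of `v` cannot lie in `C`, since its puncturing would
lie in `C'`. -/
theorem exists_punctured_code_one (hq : Fintype.card F = q ^ 2) {l : ℕ}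
    (C : Submodule F (Fin (n + 1) → F)) (hl : Module.finrank F (hermitianHull q C) = l + 1) :
    ∃ C' : Submodule F (Fin n → F), Module.finrank F C' = Module.finrank F C ∧
      Module.finrank F (hermitianHull q C') = l ∧
      ∀ v ∈ hermitianDual q (hermitianHull q C'), v ∉ C' →
        ∃ u ∈ hermitianDual q (hermitianHull q C), u ∉ C ∧
          hammingNorm u ≤ hammingNorm v + 1 := by
  obtain ⟨i, hi⟩ := exists_apply_ne_zero_of_finrank_pos (H := hermitianHull q C) (by omega)
  have hhull := hermitianHull_map_punctureMap hq hi
  have hsh := finrank_shorten hi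
  refine ⟨C.map (punctureMap F i), ?_, by rw [hhull]; omega, fun v hv hvC => ?_⟩
  · refine finrank_map_punctureMap fun c hc hc0 => ?_
    obtain ⟨h, hh, hi⟩ := hi
    have h2 := le_hermitianDual_hermitianHull hq C hc h hh
    rw [sum_mul_pow_succAbove i, hc0] at h2
    simp only [Pi.zero_apply, zero_mul, Finset.sum_const_zero, add_zero] at h2
    have hci : c i = 0 := (mul_eq_zero.1 h2).resolve_right (pow_ne_zero q hi)
    rw [← insertZeroMap_punctureMap hci, hc0, map_zero]
  · rw [hhull] at hv
    obtain ⟨u, hu, rfl⟩ := exists_mem_hermitianDual_of_shorten hq hi hv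
    exact ⟨u, hu, fun huC => hvC ⟨u, huC, rfl⟩,
      hammingNorm_le_hammingNorm_punctureMap_add_one i u⟩

/-- Repeated puncturing at coordinates on which the hull does not vanish. -/
theorem exists_punctured_code (hq : Fintype.card F = q ^ 2) {m l : ℕ} (s : ℕ)
    (C : Submodule F (Fin (m + s) → F)) (hl : Module.finrank F (hermitianHull q C) = l + s) :
    ∃ C' : Submodule F (Fin m → F), Module.finrank F C' = Module.finrank F C ∧
      Module.finrank F (hermitianHull q C') = l ∧
      ∀ v ∈ hermitianDual q (hermitianHull q C'), v ∉ C' →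
        ∃ u ∈ hermitianDual q (hermitianHull q C), u ∉ C ∧ hammingNorm u ≤ hammingNorm v + s := by
  induction s with
  | zero => exact ⟨C, rfl, hl, fun v hv hvC => ⟨v, hv, hvC, le_rfl⟩⟩
  | succ s ih =>
    obtain ⟨C₁, hC₁, hl₁, hwt₁⟩ := exists_punctured_code_one (n := m + s) hq C hl
    obtain ⟨C', hC', hl', hwt⟩ := ih C₁ hl₁
    refine ⟨C', hC'.trans hC₁, hl', fun v hv hvC => ?_⟩
    obtain ⟨w, hw, hwC, hle⟩ := hwt v hv hvC
    obtain ⟨u, hu, huC, hle'⟩ := hwt₁ w hw hwC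
    exact ⟨u, hu, huC, hle'.trans (Nat.add_le_add_right hle 1)⟩

theorem exists_shortened_code_one (hq : Fintype.card F = q ^ 2) {l : ℕ}
    (H : Submodule F (Fin (n + 1) → F)) (hH : H ≤ hermitianDual q H)
    (hl : Module.finrank F H = l + 1) :
    ∃ H' : Submodule F (Fin n → F), H' ≤ hermitianDual q H' ∧ Module.finrank F H' = l ∧
      ∀ v ∈ hermitianDual q H', v ≠ 0 →
        ∃ u ∈ hermitianDual q H, u ≠ 0 ∧ hammingNorm u ≤ hammingNorm v + 1 := by
  obtain ⟨i, hi⟩ := exists_apply_ne_zero_of_finrank_pos (H := H) (by omega)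
  have hsh := finrank_shorten hi
  refine ⟨shorten i H, fun v hv w hw => ?_, by omega, fun v hv h0 => ?_⟩
  · have := hH hv _ hw
    rw [sum_mul_pow_succAbove i] at this
    simpa using this
  · obtain ⟨u, hu, rfl⟩ := exists_mem_hermitianDual_of_shorten hq hi hv
    exact ⟨u, hu, fun hu0 => h0 (by rw [hu0, map_zero]),
      hammingNorm_le_hammingNorm_punctureMap_add_one i u⟩

/-- Repeated shortening of a Hermitian self-orthogonal code. -/
theorem exists_shortened_code (hq : Fintype.card F = q ^ 2) {m l : ℕ} (s : ℕ)
    (H : Submodule F (Fin (m + s) → F)) (hH : H ≤ hermitianDual q H)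
    (hl : Module.finrank F H = l + s) :
    ∃ H' : Submodule F (Fin m → F), H' ≤ hermitianDual q H' ∧ Module.finrank F H' = l ∧
      ∀ v ∈ hermitianDual q H', v ≠ 0 →
        ∃ u ∈ hermitianDual q H, u ≠ 0 ∧ hammingNorm u ≤ hammingNorm v + s := by
  induction s with
  | zero => exact ⟨H, hH, hl, fun v hv h0 => ⟨v, hv, h0, le_rfl⟩⟩
  | succ s ih =>
    obtain ⟨H₁, hH₁, hl₁, hwt₁⟩ := exists_shortened_code_one (n := m + s) hq H hH hl
    obtain ⟨H', hH', hl', hwt⟩ := ih H₁ hH₁ hl₁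
    refine ⟨H', hH', hl', fun v hv h0 => ?_⟩
    obtain ⟨w, hw, hw0, hle⟩ := hwt v hv h0
    obtain ⟨u, hu, hu0, hle'⟩ := hwt₁ w hw hw0
    exact ⟨u, hu, hu0, hle'.trans (Nat.add_le_add_right hle 1)⟩

end PunctureShorten

/-! ### The two propagation rules -/

theorem minWeight_le_hammingNorm {F : Type*} [Field F] [DecidableEq F] {n : ℕ}
    {X : Set (Fin n → F)} {v : Fin n → F} (hv : v ∈ X) (h0 : v ≠ 0) :
    minWeight X ≤ hammingNorm v :=
  Nat.sInf_le ⟨v, hv, h0, rfl⟩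

theorem theorem5 {F : Type*} [Field F] [Fintype F] [DecidableEq F] {q n κ r δ ℓ : ℕ}
    (hq : Fintype.card F = q ^ 2)
    (C : Submodule F (Fin n → F))
    (hC : IsCliffordSubsystemSource q C κ r δ)
    (hℓ : Module.finrank F (hermitianHull q C) = ℓ) :
    (∀ s : ℕ, 1 ≤ s → s ≤ ℓ →
      ∃ Q : SubsystemCode q (n - s) κ (r + s), Q.DistanceAtLeast (δ - s)) ∧
    (IsPureSource q C δ →
      ∀ s : ℕ, 1 ≤ s → s ≤ ℓ →
        ∃ Q : SubsystemCode q (n - s) (κ + s) r, Q.DistanceAtLeast (δ - s)) := by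
  obtain ⟨-, hκ, hr, hδ⟩ := hC
  refine ⟨fun s _ hs => ?_, fun hpure s _ hs => ?_⟩
  · obtain ⟨l, rfl⟩ := Nat.exists_eq_add_of_le' hs
    obtain ⟨m, rfl⟩ := Nat.exists_eq_add_of_le' (show s ≤ n by omega)
    obtain ⟨C', hk', hl', hwt⟩ := exists_punctured_code hq s C hℓ
    rw [Nat.add_sub_cancel]
    refine SubsystemCode.exists_of_code hq C' (by omega) (by omega) fun v hv hvC => ?_
    obtain ⟨u, hu, huC, hle⟩ := hwt v hv hvC
    have := minWeight_le_hammingNorm 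
      (X := (hermitianDual q (hermitianHull q C) : Set (Fin (m + s) → F)) \ C)
      ⟨hu, huC⟩ (by rintro rfl; exact huC C.zero_mem)
    omega
  · obtain ⟨l, rfl⟩ := Nat.exists_eq_add_of_le' hs
    obtain ⟨m, rfl⟩ := Nat.exists_eq_add_of_le' (show s ≤ n by omega)
    obtain ⟨H', hH', hl', hwt⟩ := exists_shortened_code hq s (hermitianHull q C)
      (inf_le_left.trans (le_hermitianDual_hermitianHull hq C)) hℓ
    have hhull : hermitianHull q H' = H' := inf_eq_left.2 hH'
    rw [Nat.add_sub_cancel]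
    -- `H'` is its own hull, so `r = 0` and the information exponent is `(n - s) - 2 * (ℓ - s) = κ +
    -- s + r`. Purity is what bounds vectors that lie in `C`.
    obtain ⟨Q, hQ⟩ := SubsystemCode.exists_of_code (κ := κ + s + r) (r := 0) (d := δ - s) hq H'
      (by rw [hhull]; omega) (by rw [hhull]; omega) fun v hv hvC => by
        rw [hhull] at hv
        obtain ⟨u, hu, hu0, hle⟩ := hwt v hv fun h0 => hvC (h0 ▸ H'.zero_mem)
        have := minWeight_le_hammingNorm (X := (hermitianDual q (hermitianHull q C) : Set (Fin (m + s) → F)))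
          hu hu0
        rw [IsPureSource] at hpure
        omega
    exact hQ.exists_split
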